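/- Let $\mathbb D=\{z\in\mathbb C:|z|<1\}$, $\mathbb D_r=\{z\in\mathbb C:|z|<r\}$, and let $\lambda\in(-\pi/2,\pi/2)$. Put $$A_n=\left|1+ne^{-i\lambda}\right|+\left|1-ne^{-i\lambda}\right|\ (n\ge 1),\qquad B=\left|1+e^{-i\lambda}\right|-\left|1-e^{-i\lambda}\right|.$$ Let $\mathcal H'$ be the class of harmonic functions $f=h+\overline g$ on $\mathbb D$ with $h,g$ analytic in $\mathbb D$ of the form $$h(z)=z-\sum_{n=2}^\infty|a_n|z^n,\qquad g(z)=\sum_{n=1}^\infty|b_n|z^n,$$ which are sense-preserving, i.e. $|h'|^2-|g'|^2>0$ on $\mathbb D$. A domain $\Omega\ni 0$ is called $\lambda$-spirallike if $w_0\exp(-e^{i\lambda}t)\in\Omega$ for all $w_0\in\Omega$ and $t\ge 0$. Let $\mathcal{SP}_{H'}(\lambda)$ be the class of hereditarily $\lambda$-spirallike functions in $\mathcal H'$, i.e. of those $f\in\mathcal H'$ that are univalent on $\mathbb D$ and for which $f(\mathbb D_r)$ is a $\lambda$-spirallike domain for each $0<r<1$. Let $f=h+\overline g\in\mathcal H'$,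 with $a_n$, $b_n$ as above. If $$\sum_{n=2}^\infty\frac{A_n}{B}|a_n|+\sum_{n=1}^\infty\frac{A_n}{B}|b_n|\le 1,$$ then $f\in\mathcal{SP}_{H'}(\lambda)$. Conversely, if $f\in\mathcal{SP}_{H'}(\lambda)$, then $$\sum_{n=2}^\infty\frac{B}{A_n}|a_n|+\sum_{n=1}^\infty\frac{B}{A_n}|b_n|\le 1.$$ -/

import Mathlib

namespace HarmonicSpirallike

/-- The open disk `𝔻_r = {z : |z| < r}`; the unit disk is `disk 1`. -/
def disk (r : ℝ) : Set ℂ := Metric.ball (0 : ℂ) r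

/-- A domain (nonempty connected open set) `Ω` containing the origin is `lam`-spirallike if for each
`w₀ ∈ Ω` the arc `{w₀ exp (-e^{i lam} t) : t ≥ 0} ∪ {0}` of the `lam`-spiral from the origin to `w₀`
lies in `Ω`. -/
structure IsSpirallikeDomain (lam : ℝ) (Ω : Set ℂ) : Prop where
  isOpen : IsOpen Ω
  isConnected : IsConnected Ω
  zero_mem : (0 : ℂ) ∈ Ω
  arc_mem : ∀ w₀ ∈ Ω, ∀ t : ℝ, 0 ≤ t →
    w₀ * Complex.exp (-(Complex.exp (Complex.I * (lam : ℂ)) * (t : ℂ))) ∈ Ω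

/-- `f = h + conj g` is a sense-preserving harmonic function in the unit disk with `h`, `g` analytic,
`h z = z + ∑_{n ≥ 2} aₙ zⁿ` and `g z = ∑_{n ≥ 1} bₙ zⁿ`. (The values `a 0`, `a 1`, `b 0` are not used,
nor are the values of `f`, `h`, `g` off the unit disk.) -/
structure IsHRep (f h g : ℂ → ℂ) (a b : ℕ → ℂ) : Prop where
  harmonic : InnerProductSpace.HarmonicOnNhd f (disk 1)
  analytic_h : AnalyticOnNhd ℂ h (disk 1)
  analytic_g : AnalyticOnNhd ℂ g (disk 1)
  eq_add_conj : ∀ z ∈ disk 1, f z = h z + (starRingEnd ℂ) (g z)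
  series_h : ∀ z ∈ disk 1, HasSum (fun n : ℕ => a (n + 2) * z ^ (n + 2)) (h z - z)
  series_g : ∀ z ∈ disk 1, HasSum (fun n : ℕ => b (n + 1) * z ^ (n + 1)) (g z)
  jacobian_pos : ∀ z ∈ disk 1, 0 < ‖deriv h z‖ ^ 2 - ‖deriv g z‖ ^ 2

/-- The special form `h z = z - ∑_{n ≥ 2} |aₙ| zⁿ`, `g z = ∑_{n ≥ 1} |bₙ| zⁿ`. -/
def IsHPrimeRep (f h g : ℂ → ℂ) (a b : ℕ → ℂ) : Prop :=
  IsHRep f h g (fun n => -((‖a n‖ : ℝ) : ℂ)) (fun n => ((‖b n‖ : ℝ) : ℂ))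

/-- The class `𝓗`. -/
def classH : Set (ℂ → ℂ) := {f | ∃ h g a b, IsHRep f h g a b}

/-- The class `𝓗'`. -/
def classHPrime : Set (ℂ → ℂ) := {f | f ∈ classH ∧ ∃ h g a b, IsHPrimeRep f h g a b}

/-- `f` is univalent on the unit disk and `f(𝔻_r)` is a `lam`-spirallike domain for each
`0 < r < 1`. -/
def IsHereditarilySpirallike (lam : ℝ) (f : ℂ → ℂ) : Prop :=
  Set.InjOn f (disk 1) ∧ ∀ r : ℝ, 0 < r → r < 1 → IsSpirallikeDomain lam (f '' disk r)

/-- The class `𝓢𝓟_{H'}(lam)`. -/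
def classSPHPrime (lam : ℝ) : Set (ℂ → ℂ) :=
  {f | f ∈ classHPrime ∧ IsHereditarilySpirallike lam f}

/-- `Aₙ = |1 + n e^{-i lam}| + |1 - n e^{-i lam}|`. -/
noncomputable def coeffA (lam : ℝ) (n : ℕ) : ℝ :=
  ‖1 + (n : ℂ) * Complex.exp (-(Complex.I * (lam : ℂ)))‖ +
    ‖1 - (n : ℂ) * Complex.exp (-(Complex.I * (lam : ℂ)))‖

/-- `B = |1 + e^{-i lam}| - |1 - e^{-i lam}|`. -/
noncomputable def coeffB (lam : ℝ) : ℝ :=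
  ‖1 + Complex.exp (-(Complex.I * (lam : ℂ)))‖ - ‖1 - Complex.exp (-(Complex.I * (lam : ℂ)))‖

/-- `∑_{n ≥ 2} cₙ |aₙ| + ∑_{n ≥ 1} cₙ |bₙ| ≤ 1`, convergence of both series included. -/
def CoeffSumLeOne (c : ℕ → ℝ) (a b : ℕ → ℂ) : Prop :=
  Summable (fun n : ℕ => c (n + 2) * ‖a (n + 2)‖) ∧
  Summable (fun n : ℕ => c (n + 1) * ‖b (n + 1)‖) ∧
  (∑' n : ℕ, c (n + 2) * ‖a (n + 2)‖) + (∑' n : ℕ, c (n + 1) * ‖b (n + 1)‖) ≤ 1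

end HarmonicSpirallike

namespace HarmonicSpirallike

/-! On the radius `[0, 1)` both `h'` and `g'` are real, and `|h'| > g' ≥ 0`. So `h'` keeps the sign
of `h'(0) > 0`, which says `∑ n|aₙ|r^(n-1) + ∑ n|bₙ|r^(n-1) < 1` (`absDerivSum_add_lt`). Letting `r
→ 1` bounds `∑ n|aₙ| + ∑ n|bₙ|` by 1, and `B ≤ 2 ≤ Aₙ` makes the weights `B / Aₙ` at most `n`: this
is the converse.

The same inequality makes `f - id` a strict contraction on each `𝔻_r`, so `f` is univalent with open
images. For spirallikeness put `e = e^{-iλ}` and `D = z h' - conj (z g')`. The condition on `Aₙ / B`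
yields `|f - eD| ≤ |f + eD|`, that is `Re (e D conj f) ≥ 0` (`re_nonneg`). Pulled back by `f`, a
spiral becomes a curve `z(t)` for which the Jacobian times `Re (conj z · z')` equals `-Re (e D conj
f)` (`re_conj_mul_mul_eq`). Hence `|z(t)|` does not increase and the spiral stays in `f(𝔻_r)`. -/

theorem mem_disk {r : ℝ} {z : ℂ} : z ∈ disk r ↔ ‖z‖ < r := mem_ball_zero_iff

theorem isOpen_disk (r : ℝ) : IsOpen (disk r) := Metric.isOpen_ball

theorem disk_subset_disk {r s : ℝ} (h : r ≤ s) : disk r ⊆ disk s := Metric.ball_subset_ball h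

theorem ofReal_mem_disk {r : ℝ} (h0 : 0 ≤ r) (h1 : r < 1) : (r : ℂ) ∈ disk 1 := by
  rw [mem_disk, Complex.norm_real, Real.norm_of_nonneg h0]
  exact h1

/-- A power series converging in the unit disk may be differentiated term by term. -/
theorem hasSum_deriv_of_hasSum_pow {k : ℕ} {c : ℕ → ℂ} {F : ℂ → ℂ}
    (hF : ∀ z ∈ disk 1, HasSum (fun n : ℕ => c (n + k) * z ^ (n + k)) (F z))
    {z : ℂ} (hz : z ∈ disk 1) :
    HasSum (fun n : ℕ => c (n + k) * ((n + k : ℕ) * z ^ (n + k - 1))) (deriv F z) := by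
  obtain ⟨ρ, hzρ, hρ1⟩ := exists_between (mem_disk.1 hz)
  have hρ0 : 0 ≤ ρ := (norm_nonneg z).trans hzρ.le
  have hρ := ofReal_mem_disk hρ0 hρ1
  -- Absolute convergence at the single point `ρ` majorizes the series on `disk ρ`.
  have hu := (hF ρ hρ).summable.norm
  have key := Complex.hasSum_deriv_of_summable_norm (U := disk ρ)
    (F := fun (n : ℕ) (z : ℂ) => c (n + k) * z ^ (n + k)) (z := z) hu
    (fun n => by fun_prop) (isOpen_disk ρ) (fun n w hw => by
      rw [norm_mul, norm_mul, norm_pow, norm_pow, Complex.norm_real, Real.norm_of_nonneg hρ0]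
      have := (mem_disk.1 hw).le
      gcongr) (mem_disk.2 hzρ)
  have hev : (fun w => ∑' n : ℕ, c (n + k) * w ^ (n + k)) =ᶠ[nhds z] F := by
    filter_upwards [(isOpen_disk 1).mem_nhds hz] with w hw using (hF w hw).tsum_eq
  rw [hev.deriv_eq] at key
  refine key.congr_fun fun n => ?_
  rw [deriv_const_mul _ (by fun_prop), deriv_pow_field]

/-- The sum of `n |cₙ| r^(n-1)` over `n ≥ k`. -/
noncomputable def absDerivSum (k : ℕ) (c : ℕ → ℂ) (r : ℝ) : ℝ :=
  ∑' n : ℕ, ‖c (n + k)‖ * ((n + k : ℕ) * r ^ (n + k - 1))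

/-! ### Power series with nonnegative coefficients -/

section PowerSeries

variable {k : ℕ} {c : ℕ → ℂ} {F : ℂ → ℂ}

theorem hasSum_absDerivSum
    (hF : ∀ z ∈ disk 1, HasSum (fun n : ℕ => ((‖c (n + k)‖ : ℝ) : ℂ) * z ^ (n + k)) (F z))
    {r : ℝ} (h0 : 0 ≤ r) (h1 : r < 1) :
    HasSum (fun n : ℕ => ‖c (n + k)‖ * ((n + k : ℕ) * r ^ (n + k - 1))) (absDerivSum k c r) := by
  refine Summable.hasSum ?_
  have := (hasSum_deriv_of_hasSum_pow (c := fun n => ((‖c n‖ : ℝ) : ℂ)) hF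
    (ofReal_mem_disk h0 h1)).summable
  rw [← Complex.summable_ofReal]
  refine this.congr fun n => ?_
  push_cast
  rfl

theorem deriv_ofReal_eq_absDerivSum
    (hF : ∀ z ∈ disk 1, HasSum (fun n : ℕ => ((‖c (n + k)‖ : ℝ) : ℂ) * z ^ (n + k)) (F z))
    {r : ℝ} (h0 : 0 ≤ r) (h1 : r < 1) : deriv F r = (absDerivSum k c r : ℝ) := by
  refine (hasSum_deriv_of_hasSum_pow (c := fun n => ((‖c n‖ : ℝ) : ℂ)) hF
    (ofReal_mem_disk h0 h1)).unique ?_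
  refine (Complex.hasSum_ofReal.2 (hasSum_absDerivSum hF h0 h1)).congr_fun fun n => ?_
  push_cast
  rfl

theorem absDerivSum_nonneg {r : ℝ} (h0 : 0 ≤ r) : 0 ≤ absDerivSum k c r :=
  tsum_nonneg fun n => by positivity

theorem norm_deriv_le_absDerivSum
    (hF : ∀ z ∈ disk 1, HasSum (fun n : ℕ => ((‖c (n + k)‖ : ℝ) : ℂ) * z ^ (n + k)) (F z))
    {r : ℝ} {z : ℂ} (hz : ‖z‖ ≤ r) (h1 : r < 1) : ‖deriv F z‖ ≤ absDerivSum k c r := by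
  have h0 : 0 ≤ r := (norm_nonneg z).trans hz
  refine (hasSum_deriv_of_hasSum_pow (c := fun n => ((‖c n‖ : ℝ) : ℂ)) hF
    (mem_disk.2 (hz.trans_lt h1))).norm_le_of_bounded (hasSum_absDerivSum hF h0 h1) fun n => ?_
  rw [norm_mul, norm_mul, norm_pow, Complex.norm_real, norm_norm, Complex.norm_natCast]
  gcongr

end PowerSeries

/-! ### Coefficient bounds from sense-preservation -/

section Class

variable {f h g : ℂ → ℂ} {a b : ℕ → ℂ}

theorem IsHPrimeRep.hasSum_sub (hf : IsHPrimeRep f h g a b) {z : ℂ} (hz : z ∈ disk 1) :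
    HasSum (fun n : ℕ => ((‖a (n + 2)‖ : ℝ) : ℂ) * z ^ (n + 2)) (z - h z) := by
  simpa using (hf.series_h z hz).neg

theorem IsHPrimeRep.hasSum_g (hf : IsHPrimeRep f h g a b) {z : ℂ} (hz : z ∈ disk 1) :
    HasSum (fun n : ℕ => ((‖b (n + 1)‖ : ℝ) : ℂ) * z ^ (n + 1)) (g z) :=
  hf.series_g z hz

theorem IsHPrimeRep.deriv_sub (hf : IsHPrimeRep f h g a b) {z : ℂ} (hz : z ∈ disk 1) :
    deriv (fun z => z - h z) z = 1 - deriv h z := by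
  rw [deriv_fun_sub differentiableAt_fun_id (hf.analytic_h z hz).differentiableAt, deriv_id'']

/-- Sense-preservation on the radius `[0, 1)`, read off from the signs of the coefficients. -/
theorem IsHPrimeRep.absDerivSum_add_lt (hf : IsHPrimeRep f h g a b) {r : ℝ} (h0 : 0 ≤ r)
    (h1 : r < 1) : absDerivSum 2 a r + absDerivSum 1 b r < 1 := by
  have hder : ∀ s : ℝ, 0 ≤ s → s < 1 → deriv h s = ((1 - absDerivSum 2 a s : ℝ) : ℂ) := by
    intro s hs0 hs1
    have := deriv_ofReal_eq_absDerivSum (fun z hz => hf.hasSum_sub hz) hs0 hs1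
    rw [hf.deriv_sub (ofReal_mem_disk hs0 hs1)] at this
    push_cast
    rw [← this]
    ring
  have hjac : ∀ s : ℝ, 0 ≤ s → s < 1 → absDerivSum 1 b s < |1 - absDerivSum 2 a s| := by
    intro s hs0 hs1
    have := hf.jacobian_pos s (ofReal_mem_disk hs0 hs1)
    rw [hder s hs0 hs1, deriv_ofReal_eq_absDerivSum (fun z hz => hf.hasSum_g hz) hs0 hs1,
      Complex.norm_real, Complex.norm_real, Real.norm_eq_abs, Real.norm_eq_abs] at this
    rw [← abs_of_nonneg (absDerivSum_nonneg (k := 1) (c := b) hs0)]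
    exact lt_of_pow_lt_pow_left₀ 2 (abs_nonneg _) (by linarith)
  have hpos : 0 < 1 - absDerivSum 2 a r := by
    -- Otherwise `h'` vanishes somewhere on `[0, r]`, where the Jacobian could not be positive.
    by_contra! hle
    have hcont : ContinuousOn (fun s : ℝ => (deriv h s).re) (Set.Icc 0 r) := by
      refine Complex.continuous_re.comp_continuousOn ?_
      refine hf.analytic_h.deriv.continuousOn.comp Complex.continuous_ofReal.continuousOn ?_
      exact fun s hs => ofReal_mem_disk hs.1 (hs.2.trans_lt h1)
    have hz : absDerivSum 2 a 0 = 0 := by simp [absDerivSum]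
    obtain ⟨s, hs, hs'⟩ := intermediate_value_Icc' h0 hcont (a := 0)
      ⟨by simpa only [hder r h0 h1, Complex.ofReal_re] using hle, by
        simp only [hder 0 le_rfl one_pos, Complex.ofReal_re, hz]; norm_num⟩
    have hs1 := hs.2.trans_lt h1
    simp only [hder s hs.1 hs1, Complex.ofReal_re] at hs'
    have h2 := hjac s hs.1 hs1
    rw [hs', abs_zero] at h2
    exact h2.not_ge (absDerivSum_nonneg hs.1)
  have := hjac r h0 h1
  rw [abs_of_pos hpos] at this
  linarith

/-- Finite sums are continuous in `r`, so `r → 1` is harmless after truncating the bound for `r <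
1`. -/
theorem IsHPrimeRep.sum_range_le_one (hf : IsHPrimeRep f h g a b) (N : ℕ) :
    ∑ n ∈ Finset.range N, ‖a (n + 2)‖ * (n + 2 : ℕ) +
      ∑ n ∈ Finset.range N, ‖b (n + 1)‖ * (n + 1 : ℕ) ≤ 1 := by
  set S : ℝ → ℝ := fun r =>
    ∑ n ∈ Finset.range N, ‖a (n + 2)‖ * ((n + 2 : ℕ) * r ^ (n + 2 - 1)) +
      ∑ n ∈ Finset.range N, ‖b (n + 1)‖ * ((n + 1 : ℕ) * r ^ (n + 1 - 1)) with hS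
  have hlim : Filter.Tendsto S (nhdsWithin 1 (Set.Iio 1)) (nhds (S 1)) :=
    (Continuous.tendsto (by fun_prop) 1).mono_left nhdsWithin_le_nhds
  have hle : S 1 ≤ 1 := by
    refine le_of_tendsto hlim ?_
    filter_upwards [Ioo_mem_nhdsLT (zero_lt_one' ℝ)] with r hr
    refine le_trans (add_le_add ?_ ?_) (hf.absDerivSum_add_lt hr.1.le hr.2).le
    · have := hr.1.le
      exact (hasSum_absDerivSum (fun z hz => hf.hasSum_sub hz) this hr.2).summable.sum_le_tsum _
        fun n _ => by positivity
    · have := hr.1.le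
      exact (hasSum_absDerivSum (fun z hz => hf.hasSum_g hz) this hr.2).summable.sum_le_tsum _
        fun n _ => by positivity
  simpa [hS] using hle

/-- Coefficient sums with weights at most `n` are at most one. -/
theorem IsHPrimeRep.coeffSumLeOne (hf : IsHPrimeRep f h g a b) {c : ℕ → ℝ}
    (hc0 : ∀ n, 0 ≤ c n) (hc : ∀ n : ℕ, 1 ≤ n → c n ≤ n) : CoeffSumLeOne c a b := by
  have hA : ∀ n : ℕ, c (n + 2) * ‖a (n + 2)‖ ≤ ‖a (n + 2)‖ * (n + 2 : ℕ) := fun n => by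
    rw [mul_comm]
    exact mul_le_mul_of_nonneg_left (hc _ (by omega)) (norm_nonneg _)
  have hB : ∀ n : ℕ, c (n + 1) * ‖b (n + 1)‖ ≤ ‖b (n + 1)‖ * (n + 1 : ℕ) := fun n => by
    rw [mul_comm]
    exact mul_le_mul_of_nonneg_left (hc _ (by omega)) (norm_nonneg _)
  have hA0 : ∀ n : ℕ, 0 ≤ c (n + 2) * ‖a (n + 2)‖ := fun n => mul_nonneg (hc0 _) (norm_nonneg _)
  have hB0 : ∀ n : ℕ, 0 ≤ c (n + 1) * ‖b (n + 1)‖ := fun n => mul_nonneg (hc0 _) (norm_nonneg _)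
  have hsum : ∀ N : ℕ, ∑ n ∈ Finset.range N, c (n + 2) * ‖a (n + 2)‖ +
      ∑ n ∈ Finset.range N, c (n + 1) * ‖b (n + 1)‖ ≤ 1 := fun N =>
    (add_le_add (Finset.sum_le_sum fun n _ => hA n) (Finset.sum_le_sum fun n _ => hB n)).trans
      (hf.sum_range_le_one N)
  have sA : Summable fun n : ℕ => c (n + 2) * ‖a (n + 2)‖ :=
    summable_of_sum_range_le (c := 1) hA0 fun N => by
      have := Finset.sum_nonneg fun n (_ : n ∈ Finset.range N) => hB0 n
      linarith [hsum N]
  have sB : Summable fun n : ℕ => c (n + 1) * ‖b (n + 1)‖ :=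
    summable_of_sum_range_le (c := 1) hB0 fun N => by
      have := Finset.sum_nonneg fun n (_ : n ∈ Finset.range N) => hA0 n
      linarith [hsum N]
  exact ⟨sA, sB, le_of_tendsto' (sA.hasSum.tendsto_sum_nat.add sB.hasSum.tendsto_sum_nat) hsum⟩

end Class

/-! ### The constants `Aₙ` and `B` -/

section Constants

variable {lam : ℝ}

theorem coeffA_ge_two (lam : ℝ) (n : ℕ) : 2 ≤ coeffA lam n := by
  have := norm_add_le (1 + (n : ℂ) * Complex.exp (-(Complex.I * (lam : ℂ))))
    (1 - (n : ℂ) * Complex.exp (-(Complex.I * (lam : ℂ))))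
  rw [add_add_sub_cancel, one_add_one_eq_two, Complex.norm_two] at this
  exact this

theorem coeffB_le_two (lam : ℝ) : coeffB lam ≤ 2 := by
  have := norm_sub_norm_le (1 + Complex.exp (-(Complex.I * (lam : ℂ))))
    (-(1 - Complex.exp (-(Complex.I * (lam : ℂ)))))
  rw [norm_neg, show 1 + Complex.exp (-(Complex.I * (lam : ℂ))) -
    -(1 - Complex.exp (-(Complex.I * (lam : ℂ)))) = 2 by ring, Complex.norm_two] at this
  exact this

/-- `|1 ± e^{-iλ}|² = 2 ± 2 cos λ`, and `cos λ > 0`. -/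
theorem coeffB_pos (hlam : lam ∈ Set.Ioo (-(Real.pi / 2)) (Real.pi / 2)) : 0 < coeffB lam := by
  have hre : (Complex.exp (-(Complex.I * (lam : ℂ)))).re = Real.cos lam := by
    rw [show -(Complex.I * (lam : ℂ)) = ((-lam : ℝ) : ℂ) * Complex.I by push_cast; ring,
      Complex.exp_ofReal_mul_I_re, Real.cos_neg]
  have hcos := Real.cos_pos_of_mem_Ioo hlam
  rw [coeffB, sub_pos]
  refine lt_of_pow_lt_pow_left₀ 2 (norm_nonneg _) ?_
  rw [Complex.sq_norm, Complex.sq_norm, Complex.normSq_add, Complex.normSq_sub]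
  simp only [one_mul, Complex.conj_re, hre]
  linarith

theorem coeffB_div_coeffA_nonneg (hlam : lam ∈ Set.Ioo (-(Real.pi / 2)) (Real.pi / 2)) (n : ℕ) :
    0 ≤ coeffB lam / coeffA lam n :=
  div_nonneg (coeffB_pos hlam).le (zero_le_two.trans (coeffA_ge_two lam n))

theorem coeffB_div_coeffA_le_one (lam : ℝ) (n : ℕ) : coeffB lam / coeffA lam n ≤ 1 :=
  div_le_one_of_le₀ ((coeffB_le_two lam).trans (coeffA_ge_two lam n))
    (zero_le_two.trans (coeffA_ge_two lam n))

end Constants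

/-! ### Univalence and local invertibility -/

section Univalence

variable {f h g : ℂ → ℂ} {a b : ℕ → ℂ}

/-- On each disk `𝔻_r`, `r < 1`, the map `f` is a contractive perturbation of the identity. -/
theorem IsHPrimeRep.exists_approximatesLinearOn (hf : IsHPrimeRep f h g a b) {r : ℝ} (h0 : 0 ≤ r)
    (h1 : r < 1) : ∃ c : NNReal, c < 1 ∧
      ApproximatesLinearOn f (ContinuousLinearEquiv.refl ℝ ℂ : ℂ →L[ℝ] ℂ) (disk r) c := by
  have hsub := disk_subset_disk h1.le
  have hH : ∀ x ∈ disk r, ∀ y ∈ disk r,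
      ‖(x - h x) - (y - h y)‖ ≤ absDerivSum 2 a r * ‖x - y‖ := fun x hx y hy =>
    (convex_ball (0 : ℂ) r).norm_image_sub_le_of_norm_deriv_le (f := fun z => z - h z)
      (fun z hz => differentiableAt_fun_id.sub (hf.analytic_h z (hsub hz)).differentiableAt)
      (fun z hz => norm_deriv_le_absDerivSum (fun z hz => hf.hasSum_sub hz)
        (mem_disk.1 hz).le h1) hy hx
  have hG : ∀ x ∈ disk r, ∀ y ∈ disk r, ‖g x - g y‖ ≤ absDerivSum 1 b r * ‖x - y‖ :=
    fun x hx y hy => (convex_ball (0 : ℂ) r).norm_image_sub_le_of_norm_deriv_le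
      (fun z hz => (hf.analytic_g z (hsub hz)).differentiableAt)
      (fun z hz => norm_deriv_le_absDerivSum (fun z hz => hf.hasSum_g hz)
        (mem_disk.1 hz).le h1) hy hx
  refine ⟨⟨absDerivSum 2 a r + absDerivSum 1 b r,
    add_nonneg (absDerivSum_nonneg h0) (absDerivSum_nonneg h0)⟩, hf.absDerivSum_add_lt h0 h1, ?_⟩
  intro x hx y hy
  rw [hf.eq_add_conj x (hsub hx), hf.eq_add_conj y (hsub hy)]
  calc ‖h x + (starRingEnd ℂ) (g x) - (h y + (starRingEnd ℂ) (g y)) - (x - y)‖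
      = ‖(starRingEnd ℂ) (g x - g y) - ((x - h x) - (y - h y))‖ := by
        congr 1
        rw [map_sub]
        ring
    _ ≤ ‖(starRingEnd ℂ) (g x - g y)‖ + ‖(x - h x) - (y - h y)‖ := norm_sub_le _ _
    _ ≤ absDerivSum 1 b r * ‖x - y‖ + absDerivSum 2 a r * ‖x - y‖ := by
        rw [RCLike.norm_conj]
        exact add_le_add (hG x hx y hy) (hH x hx y hy)
    _ = (absDerivSum 2 a r + absDerivSum 1 b r) * ‖x - y‖ := by ring

theorem IsHPrimeRep.exists_openPartialHomeomorph (hf : IsHPrimeRep f h g a b) {r : ℝ} (h0 : 0 ≤ r)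
    (h1 : r < 1) : ∃ Φ : OpenPartialHomeomorph ℂ ℂ,
      (Φ : ℂ → ℂ) = f ∧ Φ.source = disk r ∧ Φ.target = f '' disk r := by
  obtain ⟨c, hc, happ⟩ := hf.exists_approximatesLinearOn h0 h1
  refine ⟨happ.toOpenPartialHomeomorph f (disk r) (Or.inr ?_) (isOpen_disk r), rfl, rfl, rfl⟩
  -- The inverse function theorem needs a constant below `‖id⁻¹‖⁻¹ = 1`.
  have : ‖((ContinuousLinearEquiv.refl ℝ ℂ).symm : ℂ →L[ℝ] ℂ)‖₊ = 1 := by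
    rw [← NNReal.coe_inj]
    exact ContinuousLinearMap.norm_id
  rwa [this, inv_one]

theorem IsHPrimeRep.injOn (hf : IsHPrimeRep f h g a b) : Set.InjOn f (disk 1) := by
  intro x hx y hy hxy
  obtain ⟨r, hr, hr1⟩ := exists_between (max_lt (mem_disk.1 hx) (mem_disk.1 hy))
  obtain ⟨Φ, hΦ, hs, -⟩ := hf.exists_openPartialHomeomorph
    ((norm_nonneg x).trans ((le_max_left _ _).trans hr.le)) hr1
  refine Φ.injOn ?_ ?_ (by rwa [hΦ])
  · rw [hs, mem_disk]
    exact (le_max_left _ _).trans_lt hr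
  · rw [hs, mem_disk]
    exact (le_max_right _ _).trans_lt hr

/-- A nonzero kernel vector of the real differential would force `|h'| = |g'|`. -/
theorem IsHPrimeRep.hasFDerivAt (hf : IsHPrimeRep f h g a b) {z : ℂ} (hz : z ∈ disk 1) :
    ∃ L : ℂ ≃L[ℝ] ℂ, HasFDerivAt f (L : ℂ →L[ℝ] ℂ) z ∧
      ∀ ζ, L ζ = deriv h z * ζ + (starRingEnd ℂ) (deriv g z * ζ) := by
  have hh := (hf.analytic_h z hz).differentiableAt.hasDerivAt.hasFDerivAt.restrictScalars ℝ
  have hg := (hf.analytic_g z hz).differentiableAt.hasDerivAt.hasFDerivAt.restrictScalars ℝ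
  have hc := hh.add ((Complex.conjCLE : ℂ →L[ℝ] ℂ).hasFDerivAt.comp z hg)
  obtain ⟨L', hL', hc'⟩ : ∃ L' : ℂ →L[ℝ] ℂ,
      (∀ ζ, L' ζ = deriv h z * ζ + (starRingEnd ℂ) (deriv g z * ζ)) ∧ HasFDerivAt f L' z := by
    refine ⟨_, fun ζ => ?_, hc.congr_of_eventuallyEq ?_⟩
    · simp [mul_comm]
    · filter_upwards [(isOpen_disk 1).mem_nhds hz] with w hw
      simpa using hf.eq_add_conj w hw
  have hinj : Function.Injective (L' : ℂ →ₗ[ℝ] ℂ) := by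
    refine (injective_iff_map_eq_zero _).2 fun ζ hζ => ?_
    have h0 : deriv h z * ζ + (starRingEnd ℂ) (deriv g z * ζ) = 0 := by
      rw [← hL']
      exact hζ
    have h1 := congrArg norm (eq_neg_of_add_eq_zero_left h0)
    rw [norm_neg, RCLike.norm_conj, norm_mul, norm_mul] at h1
    by_contra hne
    have h2 := hf.jacobian_pos z hz
    rw [mul_right_cancel₀ (norm_ne_zero_iff.2 hne) h1, sub_self] at h2
    exact lt_irrefl _ h2
  refine ⟨(LinearEquiv.ofInjectiveEndo _ hinj).toContinuousLinearEquiv, ?_, fun ζ => hL' ζ⟩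
  convert hc' using 1
  exact ContinuousLinearMap.ext fun ζ => rfl

end Univalence

/-! ### Spirals pulled back to the disk -/

section Spiral

variable {f h g : ℂ → ℂ} {a b : ℕ → ℂ}

/-- The operator `F + s z F'` multiplies the `n`-th coefficient by `1 + n s`, and `|z|^n ≤ |z|` for
`n ≥ 1`. -/
theorem norm_add_mul_deriv_le {k : ℕ} (hk : k ≠ 0) {c : ℕ → ℂ} {F : ℂ → ℂ}
    (hF : ∀ z ∈ disk 1, HasSum (fun n : ℕ => ((‖c (n + k)‖ : ℝ) : ℂ) * z ^ (n + k)) (F z))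
    {s : ℂ} (hs : Summable fun n : ℕ => ‖1 + ((n + k : ℕ) : ℂ) * s‖ * ‖c (n + k)‖)
    {z : ℂ} (hz : z ∈ disk 1) :
    ‖F z + s * (z * deriv F z)‖ ≤ (∑' n : ℕ, ‖1 + ((n + k : ℕ) : ℂ) * s‖ * ‖c (n + k)‖) * ‖z‖ := by
  have hD := hasSum_deriv_of_hasSum_pow (c := fun n => ((‖c n‖ : ℝ) : ℂ)) hF hz
  refine ((hF z hz).add ((hD.mul_left z).mul_left s)).norm_le_of_bounded
    (hs.hasSum.mul_right ‖z‖) fun n => ?_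
  have hpow : z * z ^ (n + k - 1) = z ^ (n + k) := by
    rw [← pow_succ']
    congr 1
    omega
  calc ‖((‖c (n + k)‖ : ℝ) : ℂ) * z ^ (n + k) +
        s * (z * (((‖c (n + k)‖ : ℝ) : ℂ) * ((n + k : ℕ) * z ^ (n + k - 1))))‖
      = ‖(1 + ((n + k : ℕ) : ℂ) * s) * ((‖c (n + k)‖ : ℝ) : ℂ) * z ^ (n + k)‖ := by
        congr 1
        linear_combination s * ((‖c (n + k)‖ : ℝ) : ℂ) * ((n + k : ℕ) : ℂ) * hpow
    _ = ‖1 + ((n + k : ℕ) : ℂ) * s‖ * ‖c (n + k)‖ * ‖z‖ ^ (n + k) := by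
        rw [norm_mul, norm_mul, norm_pow, Complex.norm_real, norm_norm]
    _ ≤ ‖1 + ((n + k : ℕ) : ℂ) * s‖ * ‖c (n + k)‖ * ‖z‖ := by
        gcongr
        exact pow_le_of_le_one (norm_nonneg z) (mem_disk.1 hz).le (by omega)

/-- To be used with `s = ± e^{-iλ}`. Conjugation turns `s` into `-conj s` for `g`, whence the
factors `|1 - n s|` on the `bₙ`. -/
theorem IsHPrimeRep.norm_add_mul_sub_le (hf : IsHPrimeRep f h g a b) {s : ℂ}
    (hsa : Summable fun n : ℕ => ‖1 + ((n + 2 : ℕ) : ℂ) * s‖ * ‖a (n + 2)‖)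
    (hsb : Summable fun n : ℕ => ‖1 - ((n + 1 : ℕ) : ℂ) * s‖ * ‖b (n + 1)‖)
    {z : ℂ} (hz : z ∈ disk 1) :
    ‖f z + s * (z * deriv h z - (starRingEnd ℂ) (z * deriv g z)) - (1 + s) * z‖ ≤
      ((∑' n : ℕ, ‖1 + ((n + 2 : ℕ) : ℂ) * s‖ * ‖a (n + 2)‖) +
        ∑' n : ℕ, ‖1 - ((n + 1 : ℕ) : ℂ) * s‖ * ‖b (n + 1)‖) * ‖z‖ := by
  have hnorm : ∀ n : ℕ, ‖1 + ((n + 1 : ℕ) : ℂ) * (starRingEnd ℂ) (-s)‖ =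
      ‖1 - ((n + 1 : ℕ) : ℂ) * s‖ := fun n => by
    rw [← RCLike.norm_conj]
    congr 1
    simp [sub_eq_add_neg]
  have hA := norm_add_mul_deriv_le two_ne_zero (fun z hz => hf.hasSum_sub hz) hsa hz
  have hB := norm_add_mul_deriv_le one_ne_zero (fun z hz => hf.hasSum_g hz)
    (s := (starRingEnd ℂ) (-s)) (by simpa only [hnorm] using hsb) hz
  simp only [hnorm] at hB
  rw [hf.deriv_sub hz] at hA
  rw [hf.eq_add_conj z hz]
  calc _ = ‖(starRingEnd ℂ) (g z + (starRingEnd ℂ) (-s) * (z * deriv g z)) -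
        ((z - h z) + s * (z * (1 - deriv h z)))‖ := by
        congr 1
        simp only [map_add, map_mul, map_neg, Complex.conj_conj]
        ring
    _ ≤ _ := norm_sub_le _ _
    _ ≤ _ := by
        rw [RCLike.norm_conj, add_mul, add_comm]
        exact add_le_add hA hB

/-- The coefficient condition gives the (weak) analytic characterization of spirallikeness. -/
theorem IsHPrimeRep.re_nonneg (hf : IsHPrimeRep f h g a b) {lam : ℝ} (hB : 0 < coeffB lam)
    (hs : CoeffSumLeOne (fun n => coeffA lam n / coeffB lam) a b) {z : ℂ} (hz : z ∈ disk 1) :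
    0 ≤ (Complex.exp (-(Complex.I * (lam : ℂ))) *
      (z * deriv h z - (starRingEnd ℂ) (z * deriv g z)) * (starRingEnd ℂ) (f z)).re := by
  obtain ⟨hsa, hsb, hle⟩ := hs
  simp only [div_mul_eq_mul_div] at hsa hsb hle
  rw [tsum_div_const, tsum_div_const, ← add_div, div_le_one hB] at hle
  replace hsa := (summable_div_const_iff hB.ne').1 hsa
  replace hsb := (summable_div_const_iff hB.ne').1 hsb
  simp only [coeffA, coeffB] at hsa hsb hle
  set e := Complex.exp (-(Complex.I * (lam : ℂ))) with he
  set D := z * deriv h z - (starRingEnd ℂ) (z * deriv g z) with hD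
  have a1 : Summable fun n : ℕ => ‖1 + ((n + 2 : ℕ) : ℂ) * e‖ * ‖a (n + 2)‖ :=
    hsa.of_nonneg_of_le (fun n => by positivity) fun n => by
      gcongr
      exact le_add_of_nonneg_right (norm_nonneg _)
  have a2 : Summable fun n : ℕ => ‖1 - ((n + 2 : ℕ) : ℂ) * e‖ * ‖a (n + 2)‖ :=
    hsa.of_nonneg_of_le (fun n => by positivity) fun n => by
      gcongr
      exact le_add_of_nonneg_left (norm_nonneg _)
  have b1 : Summable fun n : ℕ => ‖1 + ((n + 1 : ℕ) : ℂ) * e‖ * ‖b (n + 1)‖ :=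
    hsb.of_nonneg_of_le (fun n => by positivity) fun n => by
      gcongr
      exact le_add_of_nonneg_right (norm_nonneg _)
  have b2 : Summable fun n : ℕ => ‖1 - ((n + 1 : ℕ) : ℂ) * e‖ * ‖b (n + 1)‖ :=
    hsb.of_nonneg_of_le (fun n => by positivity) fun n => by
      gcongr
      exact le_add_of_nonneg_left (norm_nonneg _)
  have hplus := hf.norm_add_mul_sub_le a1 b2 hz
  have hminus := hf.norm_add_mul_sub_le (s := -e)
    (by simpa only [mul_neg, ← sub_eq_add_neg] using a2)
    (by simpa only [mul_neg, sub_neg_eq_add] using b1) hz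
  simp only [mul_neg, neg_mul, ← sub_eq_add_neg, sub_neg_eq_add] at hminus
  rw [← hD] at hplus hminus
  simp only [add_mul] at hle
  rw [a1.tsum_add a2, b1.tsum_add b2] at hle
  have h2 := norm_add_le (f z - e * D - (1 - e) * z) ((1 - e) * z)
  rw [sub_add_cancel, norm_mul] at h2
  have h3 := norm_sub_norm_le ((1 + e) * z) (-(f z + e * D - (1 + e) * z))
  rw [norm_neg, show (1 + e) * z - -(f z + e * D - (1 + e) * z) = f z + e * D by ring,
    norm_mul] at h3
  -- The two estimates differ by exactly `B - ∑ Aₙ|aₙ| - ∑ Aₙ|bₙ| ≥ 0` times `|z|`.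
  have h4 : ‖f z - e * D‖ ≤ ‖f z + e * D‖ := by
    have := mul_le_mul_of_nonneg_right hle (norm_nonneg z)
    linarith
  have h5 := pow_le_pow_left₀ (norm_nonneg _) h4 2
  rw [Complex.sq_norm, Complex.sq_norm, Complex.normSq_sub, Complex.normSq_add] at h5
  have h6 : (e * D * (starRingEnd ℂ) (f z)).re = (f z * (starRingEnd ℂ) (e * D)).re := by
    rw [← Complex.conj_re, map_mul, Complex.conj_conj, mul_comm]
  rw [h6]
  linarith

/-- Cramer's rule: `conj ζ` is eliminated between the equation and its conjugate. Here `p = h'`, `q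
= g'`, `u = f z`, and `ζ` is the velocity of the preimage `z` of a point moving along the spiral. -/
theorem re_conj_mul_mul_eq {e p q u z ζ : ℂ}
    (h : p * ζ + (starRingEnd ℂ) (q * ζ) = -((starRingEnd ℂ) e * u)) :
    (‖p‖ ^ 2 - ‖q‖ ^ 2) * ((starRingEnd ℂ) z * ζ).re =
      -(e * (z * p - (starRingEnd ℂ) (z * q)) * (starRingEnd ℂ) u).re := by
  have h' := congrArg (starRingEnd ℂ) h
  simp only [map_add, map_mul, map_neg, Complex.conj_conj] at h h'
  have key : ((‖p‖ ^ 2 - ‖q‖ ^ 2 : ℝ) : ℂ) * ((starRingEnd ℂ) z * ζ) =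
      -((starRingEnd ℂ) (e * (z * p) * (starRingEnd ℂ) u)) +
        e * (starRingEnd ℂ) (z * q) * (starRingEnd ℂ) u := by
    push_cast
    rw [← Complex.mul_conj', ← Complex.mul_conj']
    simp only [map_mul, Complex.conj_conj]
    linear_combination (starRingEnd ℂ) z * (starRingEnd ℂ) p * h -
      (starRingEnd ℂ) z * (starRingEnd ℂ) q * h'
  have := congrArg Complex.re key
  rw [Complex.re_ofReal_mul, Complex.add_re, Complex.neg_re, Complex.conj_re] at this
  rw [this, mul_sub, sub_mul, Complex.sub_re]
  ring

theorem IsHPrimeRep.mem_image_disk (hf : IsHPrimeRep f h g a b) {lam : ℝ} (hB : 0 < coeffB lam)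
    (hs : CoeffSumLeOne (fun n => coeffA lam n / coeffB lam) a b) {r : ℝ} (h1 : r < 1)
    {z₀ : ℂ} (hz₀ : z₀ ∈ disk r) {t : ℝ} (ht : 0 ≤ t) :
    f z₀ * Complex.exp (-(Complex.exp (Complex.I * (lam : ℂ)) * (t : ℂ))) ∈ f '' disk r := by
  have hr : 0 ≤ r := (norm_nonneg _).trans (mem_disk.1 hz₀).le
  have hsub := disk_subset_disk h1.le
  obtain ⟨Φ, hΦ, hsource, htarget⟩ := hf.exists_openPartialHomeomorph hr h1
  set E := Complex.exp (Complex.I * (lam : ℂ)) with hE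
  set w : ℝ → ℂ := fun t => f z₀ * Complex.exp (-(E * (t : ℂ))) with hw
  have hE' : E = (starRingEnd ℂ) (Complex.exp (-(Complex.I * (lam : ℂ)))) := by
    rw [← Complex.exp_conj, hE]
    simp
  have hwd : ∀ t : ℝ, HasDerivAt w (-(E * w t)) t := by
    intro t
    have := ((((hasDerivAt_id t).ofReal_comp.const_mul E).neg).cexp).const_mul (f z₀)
    refine this.congr_deriv ?_
    simp only [hw, id, Complex.ofReal_one, Pi.neg_apply]
    ring
  have hwc : Continuous w := continuous_iff_continuousAt.2 fun t => (hwd t).continuousAt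
  have hmaps : Metric.closedBall (0 : ℂ) ‖z₀‖ ⊆ disk r :=
    Metric.closedBall_subset_ball (mem_disk.1 hz₀)
  have hNd : ∀ t : ℝ, w t ∈ Φ.target →
      ∃ d ≤ 0, HasDerivAt (fun s => ‖Φ.symm (w s)‖ ^ 2) d t := by
    intro t ht
    have hzt : Φ.symm (w t) ∈ disk 1 := hsub (hsource ▸ Φ.map_target ht)
    have hfz : f (Φ.symm (w t)) = w t := hΦ ▸ Φ.right_inv ht
    obtain ⟨L, hL, hLa⟩ := hf.hasFDerivAt hzt
    have hd := ((Φ.hasFDerivAt_symm ht (by rwa [hΦ])).comp_hasDerivAt t (hwd t)).norm_sq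
    refine ⟨_, ?_, hd⟩
    have hζ := hLa (L.symm (-(E * w t)))
    rw [L.apply_symm_apply, hE'] at hζ
    have h2 := re_conj_mul_mul_eq (z := Φ.symm (w t)) hζ.symm
    have h3 := hf.re_nonneg hB hs hzt
    rw [hfz] at h3
    have h4 : ((starRingEnd ℂ) (Φ.symm (w t)) * L.symm (-(E * w t))).re ≤ 0 := by
      rw [hE']
      exact nonpos_of_mul_nonpos_right (by linarith) (hf.jacobian_pos _ hzt)
    rw [Function.comp_apply, Complex.inner, mul_comm _ ((starRingEnd ℂ) _)]
    exact mul_nonpos_of_nonneg_of_nonpos zero_le_two h4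
  -- The closed ball of radius `|z₀|` is compact in `disk r`, so its image is closed, and it
  -- suffices to keep the spiral inside that image.
  have hclosed : IsClosed (w ⁻¹' (f '' Metric.closedBall (0 : ℂ) ‖z₀‖)) := by
    refine IsClosed.preimage hwc (IsCompact.isClosed ?_)
    refine (isCompact_closedBall _ _).image_of_continuousOn fun z hz => ?_
    obtain ⟨L, hL, -⟩ := hf.hasFDerivAt (hsub (hmaps hz))
    exact hL.continuousAt.continuousWithinAt
  have hall : Set.Icc 0 t ⊆ w ⁻¹' (f '' Metric.closedBall (0 : ℂ) ‖z₀‖) := by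
    -- Continuous induction on `[0, t]`: the pullback makes sense only while the spiral is in
    -- `Φ.target`, so monotonicity is used near each time already reached.
    refine (hclosed.inter isClosed_Icc).Icc_subset_of_forall_mem_nhdsWithin ?_ fun x hx => ?_
    · exact ⟨z₀, by simp, by simp [hw]⟩
    obtain ⟨z, hz, hzx⟩ := hx.1
    have hxt : w x ∈ Φ.target := htarget ▸ ⟨z, hmaps hz, hzx⟩
    have hzΦ : Φ.symm (w x) = z := by
      rw [← hzx, ← hΦ]
      exact Φ.left_inv (hsource ▸ hmaps hz)
    obtain ⟨ε, hε, hball⟩ := Metric.isOpen_iff.1 (Φ.open_target.preimage hwc) x hxt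
    have hanti : AntitoneOn (fun s => ‖Φ.symm (w s)‖ ^ 2) (Metric.ball x ε) := by
      refine antitoneOn_of_deriv_nonpos (convex_ball x ε) (fun s hs => ?_) (fun s hs => ?_)
        fun s hs => ?_
      · obtain ⟨d, -, hd⟩ := hNd s (hball hs)
        exact hd.continuousAt.continuousWithinAt
      · obtain ⟨d, -, hd⟩ := hNd s (hball (interior_subset hs))
        exact hd.differentiableAt.differentiableWithinAt
      · obtain ⟨d, hd0, hd⟩ := hNd s (hball (interior_subset hs))
        rwa [hd.deriv]
    filter_upwards [mem_nhdsWithin_of_mem_nhds (Metric.ball_mem_nhds x hε), self_mem_nhdsWithin]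
      with s hsε hxs
    refine ⟨Φ.symm (w s), ?_, hΦ ▸ Φ.right_inv (hball hsε)⟩
    have := hanti (Metric.mem_ball_self hε) hsε (le_of_lt hxs)
    simp only [hzΦ] at this
    rw [mem_closedBall_zero_iff] at hz ⊢
    exact (le_of_sq_le_sq this (norm_nonneg _)).trans hz
  exact Set.image_mono hmaps (hall ⟨ht, le_rfl⟩)

theorem IsHPrimeRep.isHereditarilySpirallike (hf : IsHPrimeRep f h g a b) {lam : ℝ}
    (hB : 0 < coeffB lam) (hs : CoeffSumLeOne (fun n => coeffA lam n / coeffB lam) a b) :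
    IsHereditarilySpirallike lam f := by
  refine ⟨hf.injOn, fun r h0 h1 => ?_⟩
  have h0r : (0 : ℂ) ∈ disk r := Metric.mem_ball_self h0
  have h01 := disk_subset_disk h1.le h0r
  have hf0 : f 0 = 0 := by
    have hh : h 0 - 0 = 0 := (hf.series_h 0 h01).unique (by simp [hasSum_zero])
    have hg : g 0 = 0 := (hf.series_g 0 h01).unique (by simp [hasSum_zero])
    rw [hf.eq_add_conj 0 h01, hg, ← sub_zero (h 0), hh, map_zero, add_zero]
  refine ⟨?_, ?_, ⟨0, h0r, hf0⟩, ?_⟩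
  · obtain ⟨Φ, -, -, ht⟩ := hf.exists_openPartialHomeomorph h0.le h1
    exact ht ▸ Φ.open_target
  · refine IsConnected.image ((Metric.isConnected_ball h0)) f fun z hz => ?_
    obtain ⟨L, hL, -⟩ := hf.hasFDerivAt (disk_subset_disk h1.le hz)
    exact hL.continuousAt.continuousWithinAt
  · rintro _ ⟨z, hz, rfl⟩ t ht
    exact hf.mem_image_disk hB hs h1 hz ht

end Spiral

end HarmonicSpirallike

theorem mainTheorem3 (lam : ℝ) (hlam : lam ∈ Set.Ioo (-(Real.pi / 2)) (Real.pi / 2))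
    (f h g : ℂ → ℂ) (a b : ℕ → ℂ) (hf : HarmonicSpirallike.IsHPrimeRep f h g a b) :
    (HarmonicSpirallike.CoeffSumLeOne
        (fun n => HarmonicSpirallike.coeffA lam n / HarmonicSpirallike.coeffB lam) a b →
      f ∈ HarmonicSpirallike.classSPHPrime lam) ∧
    (f ∈ HarmonicSpirallike.classSPHPrime lam →
      HarmonicSpirallike.CoeffSumLeOne
        (fun n => HarmonicSpirallike.coeffB lam / HarmonicSpirallike.coeffA lam n) a b) := by
  refine ⟨fun hs => ⟨⟨⟨h, g, _, _, hf⟩, h, g, a, b, hf⟩,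
    hf.isHereditarilySpirallike (HarmonicSpirallike.coeffB_pos hlam) hs⟩, fun _ => ?_⟩
  refine hf.coeffSumLeOne (HarmonicSpirallike.coeffB_div_coeffA_nonneg hlam) fun n hn => ?_
  exact (HarmonicSpirallike.coeffB_div_coeffA_le_one lam n).trans (by exact_mod_cast hn)
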